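/- For $q\in[0,1]$ let $G_{n,q}$ be the binomial random graph on $n$ labelled vertices, in which each pair of distinct vertices is an edge independently with probability $q$. The domination number $\gamma(G)$ of a graph $G$ is the smallest size of a vertex set $K$ such that every vertex outside $K$ has at least one neighbor in $K$. Fix $\varepsilon\in(0,1/4]$, and let $p=p(n)\in[0,1]$ satisfy $n^{-1}\ll p\ll 1$, i.e. $n\,p(n)\to\infty$ and $p(n)\to 0$ as $n\to\infty$. Then for infinitely many $n$ there exists $q\in[p(n),2p(n)]\cap[0,1]$ such that for all real $s,t$ with $$t-s\le \frac{\varepsilon\log(nq)}{n q^{3/2}}$$ one has $$\Pr\bigl(\gamma(G_{n,q})\in[s,t]\bigr)\le 1-\varepsilon .$$ -/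

import Mathlib

open Filter Asymptotics MeasureTheory unitInterval
open scoped SimpleGraph

namespace DominationAnti

/-- `K` is a dominating set of `G`: every vertex outside `K` has a neighbor in `K`. -/
def IsDominatingSet {V : Type*} (G : SimpleGraph V) (K : Finset V) : Prop :=
  ∀ v, v ∉ K → ∃ w ∈ K, G.Adj v w

/-- The domination number of a graph on a finite vertex set: the smallest number of vertices of a
dominating set. The set of sizes is non-empty, since the whole vertex set is dominating. -/
noncomputable def dominationNumber {V : Type*} [Fintype V] (G : SimpleGraph V) : ℕ :=
  sInf {k : ℕ | ∃ K : Finset V, IsDominatingSet G K ∧ K.card = k}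

theorem exists_isDominatingSet_card_eq {V : Type*} [Fintype V] (G : SimpleGraph V) :
    ∃ K : Finset V, IsDominatingSet G K ∧ K.card = dominationNumber G :=
  Nat.sInf_mem (s := {k : ℕ | ∃ K : Finset V, IsDominatingSet G K ∧ K.card = k})
    ⟨Finset.univ.card, Finset.univ, fun v hv => absurd (Finset.mem_univ v) hv, rfl⟩

end DominationAnti

namespace DominationAnti

/-! Suppose that for every `q` in `[p, 2p]` a short interval carries more than `1 - ε ≥ 3/4` of the
mass of the domination number. Changing the edge probability by at most `√p / n` keeps the second
moment of the likelihood ratio bounded, so the intervals of neighbouring edge probabilities cannot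
be separated (`sq_binomialRandom_real_le`, `le_of_binomialRandom_real_Icc`). About `n√p` such steps
lead from `p` to `2p`, and each lowers the interval by at most its length, about `ε log(np) / (n
p^(3/2))`. The total descent is thus about `ε log(np) / p`, at most roughly `(9/32) log(np) / p`.
First-moment bounds contradict this: the domination number is typically at least `(7/8) log(np) / p`
at `p` and at most about `(1/2) log(np) / p` at `2p`, a drop of about `(3/8) log(np) / p`. -/

variable {V : Type*} [Fintype V]

/-! ### Point masses and the likelihood-ratio comparison. -/

instance : DiscreteMeasurableSpace (SimpleGraph V) := by
  refine ⟨fun S => ?_⟩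
  rw [← Set.preimage_image_eq S SimpleGraph.edgeSet_injective]
  exact SimpleGraph.measurableEmbedding_edgeSet.measurable (Set.toFinite _).measurableSet

/-- The probability of a single graph under the binomial distribution. -/
theorem binomialRandom_real_singleton (q : I) (G : SimpleGraph V) :
    (G(V, q)).real {G} =
      (q : ℝ) ^ G.edgeSet.ncard * (1 - q : ℝ) ^ ((Nat.card V).choose 2 - G.edgeSet.ncard) := by
  simp [measureReal_def, SimpleGraph.binomialRandom_singleton]

theorem ncard_edgeSet_le (G : SimpleGraph V) : G.edgeSet.ncard ≤ (Nat.card V).choose 2 := by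
  classical
  rw [← SimpleGraph.coe_edgeFinset, Set.ncard_coe_finset, Nat.card_eq_fintype_card]
  exact G.card_edgeFinset_le_card_choose_two

/-- Comparison of two binomial random graphs by the second moment of the likelihood ratio. -/
theorem sq_binomialRandom_real_le (q r : I) (hq : 0 < (q : ℝ)) (hq1 : (q : ℝ) < 1)
    (A : Set (SimpleGraph V)) :
    (G(V, r)).real A ^ 2 ≤ (G(V, q)).real A *
      (1 + ((r : ℝ) - q) ^ 2 / (q * (1 - q))) ^ (Nat.card V).choose 2 := by
  classical
  set c : ℝ := 1 + ((r : ℝ) - q) ^ 2 / (q * (1 - q)) with hc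
  have h1q : 0 < 1 - (q : ℝ) := by linarith
  have hcpos : 0 < c := by positivity
  have hcsum : c = (r : ℝ) ^ 2 / q + (1 - r : ℝ) ^ 2 / (1 - q) := by
    rw [hc]; field_simp; ring
  have hm0 : 0 ≤ (r : ℝ) ^ 2 / q / c := by positivity
  have hm1 : (1 : ℝ) - (r : ℝ) ^ 2 / q / c = (1 - r : ℝ) ^ 2 / (1 - q) / c := by
    rw [eq_div_iff hcpos.ne', sub_mul, div_mul_cancel₀ _ hcpos.ne', hcsum]; ring
  have hm1' : 0 ≤ (1 : ℝ) - (r : ℝ) ^ 2 / q / c := by rw [hm1]; positivity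
  -- Per pair, the weights `r²/q` (edge) and `(1-r)²/(1-q)` (non-edge) sum to `c`. Normalised by `c`
  -- they form a Bernoulli law with parameter `m`, so `P_r(G)² / P_q(G)` is `c ^ (n choose 2)` times
  -- the mass of `G` under `m`; Cauchy–Schwarz does the rest.
  let m : I := ⟨(r : ℝ) ^ 2 / q / c, hm0, by linarith⟩
  have hsum : ∀ u : I, (G(V, u)).real A = ∑ G ∈ A.toFinset, (G(V, u)).real {G} := by
    intro u
    rw [sum_measureReal_singleton, Set.coe_toFinset]
  have key := Finset.sum_sq_le_sum_mul_sum_of_sq_le_mul A.toFinset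
    (r := fun G => (G(V, r)).real {G}) (f := fun G => (G(V, q)).real {G})
    (g := fun G => c ^ (Nat.card V).choose 2 * (G(V, m)).real {G})
    (fun G _ => measureReal_nonneg) (fun G _ => by positivity) (by
      intro G _
      obtain ⟨d, hd⟩ := Nat.exists_eq_add_of_le (ncard_edgeSet_le G)
      simp only [binomialRandom_real_singleton, hd, Nat.add_sub_cancel_left]
      have hmv : (m : ℝ) = (r : ℝ) ^ 2 / q / c := rfl
      rw [hmv, hm1]
      simp only [div_pow, pow_add, mul_pow]
      refine le_of_eq ?_
      field_simp
      simp only [← pow_mul, mul_comm])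
  rw [← hsum, ← hsum, ← Finset.mul_sum, ← hsum] at key
  refine key.trans (mul_le_mul_of_nonneg_left ?_ measureReal_nonneg)
  exact mul_le_of_le_one_right (by positivity) measureReal_le_one

/-! ### Probabilities of missing edges and of domination by a fixed set. -/

/-- The probability that a binomial random graph contains no edge of a given set. -/
theorem binomialRandom_real_disjoint (q : I) (B : Finset (Sym2 V)) (hB : ∀ e ∈ B, ¬ e.IsDiag) :
    (G(V, q)).real {G | ∀ e ∈ B, e ∉ G.edgeSet} = (1 - q : ℝ) ^ B.card := by
  classical
  have : G(V, q) {G | ∀ e ∈ B, e ∉ G.edgeSet} =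
      (unitInterval.toNNReal (σ q) : ENNReal) ^ B.card := by
    rw [SimpleGraph.binomialRandom_eq_map, Measure.map_apply SimpleGraph.measurable_fromEdgeSet
      .of_discrete, ProbabilityTheory.setBernoulli_apply']
    have hset : (fun s : Sym2 V → Prop => {i | s i}) ⁻¹' (SimpleGraph.fromEdgeSet ⁻¹'
        {G | ∀ e ∈ B, e ∉ G.edgeSet}) = Set.pi (B : Set (Sym2 V)) (fun _ => {False}) := by
      ext s
      simp only [Set.mem_preimage, Set.mem_ofPred_eq, Set.mem_pi, Finset.mem_coe,
        SimpleGraph.edgeSet_fromEdgeSet, Set.mem_sdiff, Set.mem_singleton_iff]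
      refine forall₂_congr fun e he => ?_
      have := hB e he
      simp [this]
    rw [hset, Measure.infinitePi_pi _ (fun _ _ => .of_discrete),
      Finset.prod_congr rfl (g := fun _ => (unitInterval.toNNReal (σ q) : ENNReal)),
      Finset.prod_const]
    intro e he
    simp [hB e he]
  rw [measureReal_def, this]
  simp

theorem dominationNumber_le_card {G : SimpleGraph V} {K : Finset V} (hK : IsDominatingSet G K) :
    dominationNumber G ≤ K.card :=
  Nat.sInf_le ⟨K, hK, rfl⟩

theorem IsDominatingSet.mono {V : Type*} {G : SimpleGraph V} {K L : Finset V}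
    (hK : IsDominatingSet G K) (hKL : K ⊆ L) : IsDominatingSet G L := fun v hv =>
  let ⟨w, hw, hvw⟩ := hK v fun h => hv (hKL h)
  ⟨w, hKL hw, hvw⟩

theorem exists_isDominatingSet_of_dominationNumber_le {G : SimpleGraph V} {k : ℕ}
    (hk : dominationNumber G ≤ k) (hkV : k ≤ Fintype.card V) :
    ∃ K : Finset V, K.card = k ∧ IsDominatingSet G K := by
  obtain ⟨K, hK, hKc⟩ := exists_isDominatingSet_card_eq G
  obtain ⟨L, hKL, hL⟩ := Finset.exists_superset_card_eq (hKc.le.trans hk) hkV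
  exact ⟨L, hL, hK.mono hKL⟩

/-- Vertices outside `T` are joined to the vertices of `K` by pairwise distinct pairs. -/
theorem binomialRandom_real_forall_not_adj (q : I) (K T : Finset V) (hKT : Disjoint T K) :
    (G(V, q)).real {G | ∀ v ∈ T, ∀ w ∈ K, ¬ G.Adj v w} = (1 - q : ℝ) ^ (T.card * K.card) := by
  classical
  have hinj : Set.InjOn (fun x : V × V => s(x.1, x.2)) (T ×ˢ K : Finset (V × V)) := by
    rintro ⟨a, b⟩ hab ⟨c, d⟩ hcd h
    simp only [Finset.coe_product, Set.mem_prod, Finset.mem_coe] at hab hcd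
    rcases Sym2.eq_iff.1 h with ⟨h1, h2⟩ | ⟨h1, h2⟩
    · simp_all
    · obtain rfl : a = d := h1
      exact absurd hab.1 (Finset.disjoint_right.1 hKT hcd.2)
  have := binomialRandom_real_disjoint q ((T ×ˢ K).image fun x : V × V => s(x.1, x.2)) (by
    intro e he
    obtain ⟨⟨a, b⟩, hab, rfl⟩ := Finset.mem_image.1 he
    rw [Finset.mem_product] at hab
    rw [Sym2.mk_isDiag_iff]
    intro h
    exact Finset.disjoint_left.1 hKT hab.1 (h ▸ hab.2))
  rw [Finset.card_image_of_injOn hinj, Finset.card_product] at this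
  rw [← this]
  congr 1
  ext G
  simp only [Set.mem_ofPred_eq, Finset.mem_image, Finset.mem_product, Prod.exists,
    forall_exists_index, and_imp]
  constructor
  · rintro h e a b ha hb rfl
    exact h a ha b hb
  · exact fun h a ha b hb => h _ a b ha hb rfl

/-- Inclusion–exclusion over the sets `u` of undominated vertices: each term is a missing-edge
probability, and the sum is the binomial expansion of the right-hand side, with `u = ∅` supplying
the leading 1. -/
theorem binomialRandom_real_isDominatingSet (q : I) (K : Finset V) :
    (G(V, q)).real {G | IsDominatingSet G K} =
      (1 - (1 - q : ℝ) ^ K.card) ^ (Fintype.card V - K.card) := by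
  classical
  have hc : {G : SimpleGraph V | IsDominatingSet G K} =
      (⋃ v ∈ Kᶜ, {G : SimpleGraph V | ∀ w ∈ K, ¬ G.Adj v w})ᶜ := by
    ext G
    simp [IsDominatingSet]
  rw [hc, measureReal_compl .of_discrete,
    measureReal_biUnion_eq_sum_powerset (fun _ _ => .of_discrete)]
  have hI : ∀ u ∈ Kᶜ.powerset, (-1 : ℝ) ^ (u.card + 1) *
      (G(V, q)).real (⋂ v ∈ u, {G : SimpleGraph V | ∀ w ∈ K, ¬ G.Adj v w}) =
      - (-(1 - q : ℝ) ^ K.card) ^ u.card := by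
    intro u hu
    have hd : Disjoint u K := by
      rw [Finset.mem_powerset] at hu
      exact Finset.disjoint_left.2 fun x hx => Finset.mem_compl.1 (hu hx)
    have := binomialRandom_real_forall_not_adj q K u hd
    have hset : (⋂ v ∈ u, {G : SimpleGraph V | ∀ w ∈ K, ¬ G.Adj v w}) =
        {G | ∀ v ∈ u, ∀ w ∈ K, ¬ G.Adj v w} := by
      ext G; simp
    rw [hset, this, mul_comm u.card, pow_mul, neg_pow ((1 - q : ℝ) ^ K.card)]
    ring
  rw [Finset.sum_congr rfl fun u hu => hI u (Finset.filter_subset _ _ hu), Finset.sum_neg_distrib,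
    sub_neg_eq_add, probReal_univ, ← Finset.card_compl]
  have hb := Finset.sum_pow_mul_eq_add_pow (-(1 - q : ℝ) ^ K.card) 1 Kᶜ
  simp only [one_pow, mul_one] at hb
  rw [neg_add_eq_sub] at hb
  rw [← hb, ← Finset.sum_filter_add_sum_filter_not Kᶜ.powerset (fun u => u.Nonempty), add_comm]
  congr 1
  have : Kᶜ.powerset.filter (fun u => ¬ u.Nonempty) = {∅} := by
    ext u
    simp only [Finset.mem_filter, Finset.mem_powerset, Finset.not_nonempty_iff_eq_empty,
      Finset.mem_singleton, and_iff_right_iff_imp]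
    rintro rfl
    simp
  rw [this]
  simp

/-! ### First-moment bounds for the domination number. -/

/-- First-moment bound for the existence of a small dominating set. -/
theorem binomialRandom_real_dominationNumber_le (q : I) (k : ℕ) (hk : k ≤ Fintype.card V) :
    (G(V, q)).real {G | dominationNumber G ≤ k} ≤
      (Fintype.card V).choose k * (1 - (1 - q : ℝ) ^ k) ^ (Fintype.card V - k) := by
  classical
  calc (G(V, q)).real {G | dominationNumber G ≤ k}
      ≤ (G(V, q)).real (⋃ K ∈ Finset.univ.powersetCard k, {G | IsDominatingSet G K}) := by
        refine measureReal_mono (fun G hG => ?_) (measure_ne_top _ _)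
        obtain ⟨K, hK, hd⟩ := exists_isDominatingSet_of_dominationNumber_le hG hk
        simp only [Set.mem_iUnion]
        exact ⟨K, Finset.mem_powersetCard_univ.2 hK, hd⟩
    _ ≤ ∑ K ∈ Finset.univ.powersetCard k, (G(V, q)).real {G | IsDominatingSet G K} :=
        measureReal_biUnion_finset_le _ _
    _ = _ := by
        rw [Finset.sum_congr rfl (g := fun _ => (1 - (1 - q : ℝ) ^ k) ^ (Fintype.card V - k))]
        · simp
        · intro K hK
          rw [binomialRandom_real_isDominatingSet, Finset.mem_powersetCard_univ.1 hK]

/-- Markov bound for the number of vertices not dominated by a fixed set of `k` vertices. -/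
theorem mul_binomialRandom_real_le_dominationNumber (q : I) (k : ℕ) (hk : k ≤ Fintype.card V)
    (a : ℝ) :
    a * (G(V, q)).real {G | k + a ≤ dominationNumber G} ≤
      Fintype.card V * (1 - q : ℝ) ^ k := by
  classical
  obtain ⟨K, -, hK⟩ := Finset.exists_subset_card_eq (s := (Finset.univ : Finset V)) (n := k)
    (by simpa using hk)
  let A : V → Set (SimpleGraph V) := fun v => {G | ∀ w ∈ K, ¬ G.Adj v w}
  let X : SimpleGraph V → ℝ := fun G => ∑ v ∈ Kᶜ, (A v).indicator (fun _ => (1 : ℝ)) G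
  have hX : ∀ G, (dominationNumber G : ℝ) ≤ k + X G := by
    intro G
    -- Adding to `K` every vertex it fails to dominate gives a dominating set of size at most `k + X
    -- G`.
    have hdom : IsDominatingSet G (K ∪ Kᶜ.filter fun v => G ∈ A v) := by
      intro v hv
      simp only [Finset.mem_union, Finset.mem_filter, Finset.mem_compl, not_or, not_and] at hv
      have := hv.2 hv.1
      simp only [A, Set.mem_ofPred_eq, not_forall, not_not] at this
      obtain ⟨w, hw, h⟩ := this
      exact ⟨w, Finset.mem_union_left _ hw, h⟩
    have h1 := (dominationNumber_le_card hdom).trans (Finset.card_union_le _ _)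
    have h2 : X G = ((Kᶜ.filter fun v => G ∈ A v).card : ℝ) := by
      rw [Finset.card_filter]
      push_cast
      exact Finset.sum_congr rfl fun v _ => by by_cases h : G ∈ A v <;> simp [h]
    rw [h2, ← hK]
    exact_mod_cast h1
  have hX0 : ∀ G, 0 ≤ X G := fun G =>
    Finset.sum_nonneg fun v _ => Set.indicator_nonneg (fun _ _ => zero_le_one) _
  have hint : ∀ f : SimpleGraph V → ℝ, Integrable f G(V, q) := fun f => .of_finite
  calc a * (G(V, q)).real {G | k + a ≤ dominationNumber G}
      ≤ ∫ G, X G ∂G(V, q) := by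
        by_cases ha : a ≤ 0
        · exact (mul_nonpos_of_nonpos_of_nonneg ha measureReal_nonneg).trans
            (integral_nonneg hX0)
        · refine le_trans ?_ (mul_meas_ge_le_integral_of_nonneg (.of_forall hX0) (hint X) a)
          refine mul_le_mul_of_nonneg_left (measureReal_mono fun G hG => ?_) (not_le.1 ha).le
          have := hX G
          simp only [Set.mem_ofPred_eq] at hG ⊢
          linarith
    _ = ∑ v ∈ Kᶜ, (1 - q : ℝ) ^ k := by
        rw [integral_finsetSum _ fun _ _ => hint _]
        refine Finset.sum_congr rfl fun v hv => ?_
        rw [integral_indicator_const _ .of_discrete]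
        have := binomialRandom_real_forall_not_adj q K {v} (by simpa using hv)
        simp only [Finset.mem_singleton, forall_eq, Finset.card_singleton, one_mul, hK] at this
        simpa [A] using this
    _ ≤ Fintype.card V * (1 - q : ℝ) ^ k := by
        rw [Finset.sum_const, nsmul_eq_mul]
        have : (0 : ℝ) ≤ 1 - q := by linarith [q.2.2]
        gcongr
        exact Finset.card_le_univ _

/-! ### Explicit lower and upper tail estimates. -/

/-- A single term of the expansion of `(1 + y)^n` is at most the whole, and `1 + y ≤ exp y`. -/
theorem choose_le_exp_mul_pow (n k : ℕ) {y : ℝ} (hy : 0 < y) :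
    (n.choose k : ℝ) ≤ Real.exp (n * y) * (y⁻¹) ^ k := by
  have h1 : (n.choose k : ℝ) * y ^ k ≤ (1 + y) ^ n := by
    rcases le_or_gt k n with hk | hk
    · rw [add_comm, add_pow]
      refine le_trans (le_of_eq ?_) (Finset.single_le_sum
        (f := fun m => y ^ m * 1 ^ (n - m) * (n.choose m : ℝ)) (fun m _ => by positivity)
        (Finset.mem_range.2 (Nat.lt_succ_of_le hk)))
      simp [mul_comm]
    · rw [Nat.choose_eq_zero_of_lt hk]
      simp only [CharP.cast_eq_zero, zero_mul]
      positivity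
  have h2 : (1 + y) ^ n ≤ Real.exp (n * y) := by
    rw [Real.exp_nat_mul]
    gcongr
    linarith [Real.add_one_le_exp y]
  rw [inv_pow, ← div_eq_mul_inv, le_div_iff₀ (by positivity)]
  exact h1.trans h2

theorem exp_neg_div_le_one_sub {p : ℝ} (hp : p < 1) : Real.exp (-(p / (1 - p))) ≤ 1 - p := by
  have h : 0 < 1 - p := by linarith
  rw [Real.exp_neg, inv_le_comm₀ (Real.exp_pos _) h]
  refine le_trans (le_of_eq ?_) (Real.add_one_le_exp _)
  field_simp
  ring

/-- The domination number is unlikely to be smaller than `7/8 * log (np) / p`. -/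
theorem binomialRandom_real_dominationNumber_lt_le (n : ℕ) (p : I) (hp0 : 0 < (p : ℝ))
    (hp : (p : ℝ) ≤ 1 / 16) {l : ℝ} (hl : 0 ≤ l) (hx : (n : ℝ) * p = Real.exp l)
    (hlx : 2 * l ≤ Real.exp l) (hl2 : 4 + 2 * l ^ 2 ≤ Real.exp (l / 15)) :
    (G(Fin n, p)).real {G | (dominationNumber G : ℝ) < 7 / 8 * l / p} ≤ 1 / 2 := by
  set k : ℕ := ⌊7 / 8 * l / (p : ℝ)⌋₊ with hk
  have hκ : 0 ≤ 7 / 8 * l / (p : ℝ) := by positivity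
  have hkκ : (k : ℝ) ≤ 7 / 8 * l / p := Nat.floor_le hκ
  have hkp : (k : ℝ) * p ≤ 7 / 8 * l := (le_div_iff₀ hp0).1 hkκ
  have hkn2 : (k : ℝ) ≤ n / 2 := by
    refine hkκ.trans ((div_le_iff₀ hp0).2 ?_)
    linarith
  have hkn : k ≤ n := by
    have : (k : ℝ) ≤ n := by linarith [(Nat.cast_nonneg n : (0 : ℝ) ≤ n)]
    exact_mod_cast this
  have hsub : {G : SimpleGraph (Fin n) | (dominationNumber G : ℝ) < 7 / 8 * l / p} ⊆
      {G | dominationNumber G ≤ k} := fun G hG => Nat.le_floor (le_of_lt hG)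
  refine (measureReal_mono hsub).trans ?_
  refine (binomialRandom_real_dominationNumber_le p k (by simpa using hkn)).trans ?_
  rw [Fintype.card_fin]
  -- Here `14/15 = 7/8 * 16/15`, where `16/15` bounds `1/(1-p)`. Falling short of 1, it leaves a
  -- factor `exp (l/15)` that beats the entropy term of order `l²`.
  have hpow : Real.exp (-(14 / 15 * l)) ≤ (1 - p : ℝ) ^ k := by
    refine le_trans ?_ (pow_le_pow_left₀ (Real.exp_pos _).le
      (exp_neg_div_le_one_sub (by linarith : (p : ℝ) < 1)) k)
    rw [← Real.exp_nat_mul, Real.exp_le_exp]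
    have h1 : (p : ℝ) / (1 - p) ≤ 16 / 15 * p := by
      rw [div_le_iff₀ (by linarith)]
      nlinarith
    have h2 : (k : ℝ) * (p / (1 - p)) ≤ k * (16 / 15 * p) := by gcongr
    linarith
  have h0 : (0 : ℝ) ≤ 1 - (1 - p : ℝ) ^ k := by
    rw [sub_nonneg]
    exact pow_le_one₀ (by linarith) (by linarith)
  have hbase : (1 - (1 - p : ℝ) ^ k) ^ (n - k) ≤
      Real.exp (-((n : ℝ) / 2 * Real.exp (-(14 / 15 * l)))) := by
    refine (pow_le_pow_left₀ h0 (Real.one_sub_le_exp_neg _) _).trans ?_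
    rw [← Real.exp_nat_mul, Real.exp_le_exp, Nat.cast_sub hkn, mul_neg, neg_le_neg_iff]
    have : (n : ℝ) / 2 ≤ n - k := by linarith
    exact mul_le_mul this hpow (Real.exp_pos _).le (by linarith)
  -- The choice `y = exp (-l) = 1/(np)` makes `n * y = 1/p`.
  have hchoose := choose_le_exp_mul_pow n k (Real.exp_pos (-l))
  rw [← Real.exp_neg, neg_neg, ← Real.exp_nat_mul, ← Real.exp_add] at hchoose
  have hn : (n : ℝ) = Real.exp l / p := by rw [← hx]; field_simp
  have hp1 : 16 ≤ 1 / (p : ℝ) := by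
    rw [le_div_iff₀ hp0]; linarith
  calc (n.choose k : ℝ) * (1 - (1 - p : ℝ) ^ k) ^ (n - k)
      ≤ Real.exp (n * Real.exp (-l) + k * l) *
        Real.exp (-((n : ℝ) / 2 * Real.exp (-(14 / 15 * l)))) := by
        gcongr
    _ ≤ Real.exp (-1) := by
        rw [← Real.exp_add, Real.exp_le_exp]
        have e1 : (n : ℝ) * Real.exp (-l) = 1 / p := by
          rw [hn, div_mul_eq_mul_div, ← Real.exp_add]; simp
        have e2 : (n : ℝ) / 2 * Real.exp (-(14 / 15 * l)) = Real.exp (l / 15) / 2 * (1 / p) := by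
          rw [hn, show l / 15 = l + -(14 / 15 * l) by ring, Real.exp_add]; ring
        have e3 : (k : ℝ) * l ≤ 7 / 8 * l ^ 2 * (1 / p) := by
          calc (k : ℝ) * l ≤ 7 / 8 * l / p * l := by gcongr
            _ = _ := by ring
        rw [e1, e2]
        have : (1 + 7 / 8 * l ^ 2 - Real.exp (l / 15) / 2) * (1 / (p : ℝ)) ≤ (-1) * (1 / (p : ℝ)) := by
          refine mul_le_mul_of_nonneg_right ?_ (by positivity)
          nlinarith [sq_nonneg l]
        linarith
    _ ≤ 1 / 2 := by
        rw [Real.exp_neg, one_div]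
        refine inv_anti₀ (by norm_num) ?_
        linarith [Real.add_one_le_exp 1]

/-- The domination number is unlikely to exceed `(log (nq) + 2) / q + 1`. -/
theorem binomialRandom_real_le_dominationNumber_le (n : ℕ) (q : I) (hq0 : 0 < (q : ℝ))
    {l : ℝ} (hl : 0 ≤ l) (hx : (n : ℝ) * q = Real.exp l) (hlx : l + 1 ≤ Real.exp l) :
    (G(Fin n, q)).real {G | (l + 2) / q + 1 ≤ (dominationNumber G : ℝ)} ≤ 1 / 2 := by
  set k : ℕ := ⌈l / (q : ℝ)⌉₊ with hk
  have hκ : 0 ≤ l / (q : ℝ) := by positivity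
  have hkn : k ≤ n := by
    have h1 : (k : ℝ) < l / q + 1 := Nat.ceil_lt_add_one hκ
    have h2 : l / q + 1 ≤ (n : ℝ) := by
      rw [div_add_one hq0.ne', div_le_iff₀ hq0]
      linarith [q.2.2]
    exact_mod_cast (h1.trans_le h2).le
  -- At most `n * exp (-l) = 1/q` vertices are undominated on average, so the excess `2/q` has
  -- probability at most `1/2`.
  have hmk := mul_binomialRandom_real_le_dominationNumber (V := Fin n) q k (by simpa using hkn)
    (2 / q)
  have hsub : {G : SimpleGraph (Fin n) | (l + 2) / q + 1 ≤ (dominationNumber G : ℝ)} ⊆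
      {G | (k : ℝ) + 2 / q ≤ dominationNumber G} := by
    intro G hG
    have h1 : (k : ℝ) < l / q + 1 := Nat.ceil_lt_add_one hκ
    have hG' : (l + 2) / q + 1 ≤ (dominationNumber G : ℝ) := hG
    rw [add_div] at hG'
    simp only [Set.mem_ofPred_eq]
    linarith
  refine (measureReal_mono hsub).trans ?_
  have hpow : (1 - q : ℝ) ^ k ≤ Real.exp (-l) := by
    refine (pow_le_pow_left₀ (by linarith [q.2.2]) (Real.one_sub_le_exp_neg _) _).trans ?_
    rw [← Real.exp_nat_mul, Real.exp_le_exp, mul_neg, neg_le_neg_iff]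
    exact (div_le_iff₀ hq0).1 (Nat.le_ceil _)
  have hn : (n : ℝ) = Real.exp l / q := by rw [← hx]; field_simp
  have h3 : (n : ℝ) * (1 - q : ℝ) ^ k ≤ 1 / q := by
    calc (n : ℝ) * (1 - q : ℝ) ^ k ≤ n * Real.exp (-l) := by gcongr
      _ = 1 / q := by
        rw [hn, div_mul_eq_mul_div, ← Real.exp_add]; simp
  rw [Fintype.card_fin] at hmk
  have h4 := hmk.trans h3
  rw [div_mul_eq_mul_div, div_le_div_iff_of_pos_right hq0] at h4
  linarith

/-! ### Chaining intervals from `p` to `2p`. -/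

/-- If `r - q` is at most `√q / n`, intervals carrying more than `3/4` of the mass of a statistic
for the edge probabilities `q` and `r` are not separated. -/
theorem le_of_binomialRandom_real_Icc {n : ℕ} (q r : I) (hq : 0 < (q : ℝ)) (hq1 : (q : ℝ) ≤ 1 / 8)
    (hqr : (n : ℝ) ^ 2 * ((r : ℝ) - q) ^ 2 ≤ q) (f : SimpleGraph (Fin n) → ℝ) {s t s' t' : ℝ}
    (h : 3 / 4 < (G(Fin n, q)).real {G | f G ∈ Set.Icc s t})
    (h' : 3 / 4 < (G(Fin n, r)).real {G | f G ∈ Set.Icc s' t'}) : s ≤ t' := by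
  by_contra! hlt
  set A : Set (SimpleGraph (Fin n)) := {G | s ≤ f G}
  have hA : 3 / 4 < (G(Fin n, q)).real A := h.trans_le (measureReal_mono fun G hG => hG.1)
  have hA' : 3 / 4 < (G(Fin n, r)).real Aᶜ :=
    h'.trans_le (measureReal_mono fun G hG => not_le.2 (hG.2.trans_lt hlt))
  have hAc : (G(Fin n, q)).real Aᶜ < 1 / 4 := by
    rw [measureReal_compl .of_discrete, probReal_univ]
    linarith
  -- Since `1 - q ≥ 7/8`, the exponent is at most `4/7`, and `exp (4/7) ≤ (7/5)² < 9/4`. The value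
  -- `9/4` is just enough: `(1/4) * (9/4) = (3/4)²`, and the strict bound `3/4 < P_r(Aᶜ)` gives the
  -- contradiction.
  have hfac : (1 + ((r : ℝ) - q) ^ 2 / (q * (1 - q))) ^ (Nat.card (Fin n)).choose 2 ≤ 9 / 4 := by
    rw [Nat.card_fin]
    have h1q : 0 < 1 - (q : ℝ) := by linarith
    have hb : 1 + ((r : ℝ) - q) ^ 2 / (q * (1 - q)) ≤
        Real.exp (((r : ℝ) - q) ^ 2 / (q * (1 - q))) := by
      linarith [Real.add_one_le_exp (((r : ℝ) - q) ^ 2 / (q * (1 - q)))]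
    refine (pow_le_pow_left₀ (by positivity) hb _).trans ?_
    rw [← Real.exp_nat_mul]
    have hc : ((n.choose 2 : ℕ) : ℝ) ≤ (n : ℝ) ^ 2 / 2 := by
      rw [Nat.cast_choose_two]
      nlinarith [(Nat.cast_nonneg n : (0 : ℝ) ≤ n)]
    have hexp : ((n.choose 2 : ℕ) : ℝ) * (((r : ℝ) - q) ^ 2 / (q * (1 - q))) ≤ 4 / 7 := by
      rw [mul_div_assoc', div_le_iff₀ (by positivity)]
      have : ((n.choose 2 : ℕ) : ℝ) * ((r : ℝ) - q) ^ 2 ≤ (n : ℝ) ^ 2 / 2 * ((r : ℝ) - q) ^ 2 := by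
        gcongr
      nlinarith
    refine (Real.exp_le_exp.2 hexp).trans ?_
    have h27 : Real.exp (2 / 7) ≤ 7 / 5 := by
      have := Real.add_one_le_exp (-(2 / 7) : ℝ)
      rw [Real.exp_neg, le_inv_comm₀ (by norm_num) (Real.exp_pos _)] at this
      norm_num at this ⊢
      exact this
    rw [show (4 / 7 : ℝ) = 2 / 7 + 2 / 7 by norm_num, Real.exp_add]
    nlinarith [Real.exp_pos (2 / 7 : ℝ)]
  have hsq := sq_binomialRandom_real_le q r hq (by linarith) Aᶜ
  have : (G(Fin n, q)).real Aᶜ * (1 + ((r : ℝ) - q) ^ 2 / (q * (1 - q))) ^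
      (Nat.card (Fin n)).choose 2 ≤ (1 / 4) * (9 / 4) :=
    mul_le_mul hAc.le hfac (pow_nonneg (by
      have : 0 < 1 - (q : ℝ) := by linarith
      positivity) _) (by norm_num)
  nlinarith

theorem exists_binomialRandom_real_dominationNumber_le {ε : ℝ} (hε : 0 < ε) (hε' : ε ≤ 1 / 4)
    (n : ℕ) (p : I) (hp0 : 0 < (p : ℝ)) (hp : (p : ℝ) ≤ 1 / 16) {l : ℝ} (hl : 31 ≤ l)
    (hx : (n : ℝ) * p = Real.exp l) (hlx : 2 * l ≤ Real.exp l)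
    (hl2 : 4 + 2 * l ^ 2 ≤ Real.exp (l / 15)) :
    ∃ q : I, (p : ℝ) ≤ q ∧ (q : ℝ) ≤ 2 * p ∧
      ∀ s t : ℝ, t - s ≤ ε * Real.log ((n : ℝ) * q) / ((n : ℝ) * (q : ℝ) ^ (3 / 2 : ℝ)) →
        (G(Fin n, q)).real {G | (dominationNumber G : ℝ) ∈ Set.Icc s t} ≤ 1 - ε := by
  by_contra! hcon
  have hn0 : 0 < (n : ℝ) := by
    by_contra! h
    have := Real.exp_pos l
    nlinarith
  have hsq : √(p : ℝ) * √(p : ℝ) = p := Real.mul_self_sqrt hp0.le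
  have hs0 : 0 < √(p : ℝ) := Real.sqrt_pos.2 hp0
  set l' : ℝ := l + Real.log 2 with hl'
  have hlog2 : 0 < Real.log 2 := Real.log_pos (by norm_num)
  have hlog2' : Real.log 2 < 1 := Real.log_two_lt_d9.trans (by norm_num)
  have hl'exp : Real.exp l' = 2 * Real.exp l := by
    rw [hl', Real.exp_add, Real.exp_log (by norm_num), mul_comm]
  -- A length valid for all `q` in `[p, 2p]`: the logarithm is taken at `2p`, the denominator at
  -- `p`.
  set Λ : ℝ := ε * l' / (n * (p * √(p : ℝ))) with hΛ
  have hΛ0 : 0 < Λ := by positivity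
  have hΛbound : ∀ q : I, (p : ℝ) ≤ q → (q : ℝ) ≤ 2 * p →
      ε * Real.log ((n : ℝ) * q) / ((n : ℝ) * (q : ℝ) ^ (3 / 2 : ℝ)) ≤ Λ := by
    intro q hq hq'
    have h1 : Real.log ((n : ℝ) * q) ≤ l' := by
      rw [Real.log_le_iff_le_exp (mul_pos hn0 (hp0.trans_le hq)), hl'exp, ← hx]
      nlinarith
    have h2 : (p : ℝ) * √(p : ℝ) ≤ (q : ℝ) ^ (3 / 2 : ℝ) := by
      have : (p : ℝ) * √(p : ℝ) = (p : ℝ) ^ (3 / 2 : ℝ) := by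
        rw [Real.sqrt_eq_rpow, show (3 / 2 : ℝ) = 1 + 1 / 2 by norm_num, Real.rpow_add hp0,
          Real.rpow_one]
      rw [this]
      exact Real.rpow_le_rpow hp0.le hq (by norm_num)
    exact div_le_div₀ (by positivity) (by gcongr) (by positivity) (by gcongr)
  -- The mesh `p / M` is then at most `√p / n`, as the comparison of neighbours requires.
  set M : ℕ := ⌈(n : ℝ) * √(p : ℝ)⌉₊ with hM
  have hMle : (n : ℝ) * √(p : ℝ) ≤ M := Nat.le_ceil _
  have hMlt : (M : ℝ) < n * √(p : ℝ) + 1 := Nat.ceil_lt_add_one (by positivity)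
  have hM0 : 0 < (M : ℝ) := lt_of_lt_of_le (by positivity) hMle
  have hstep : ∀ i : ℕ, i ≤ M → ∃ q : I, ∃ s t : ℝ, (q : ℝ) = p + i * (p / M) ∧ t - s ≤ Λ ∧
      3 / 4 < (G(Fin n, q)).real {G | (dominationNumber G : ℝ) ∈ Set.Icc s t} := by
    intro i hi
    have hi' : (i : ℝ) * (p / M) ≤ p := by
      rw [mul_div_assoc', div_le_iff₀ hM0, mul_comm]
      gcongr
    have hi0 : 0 ≤ (i : ℝ) * (p / M) := by positivity
    obtain ⟨q, hq⟩ : ∃ q : I, (q : ℝ) = p + i * (p / M) :=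
      ⟨⟨p + i * (p / M), by linarith, by linarith⟩, rfl⟩
    have hpq : (p : ℝ) ≤ q := by linarith
    have hqp : (q : ℝ) ≤ 2 * p := by linarith
    obtain ⟨s, t, hst, hP⟩ := hcon q hpq hqp
    exact ⟨q, s, t, hq, hst.trans (hΛbound q hpq hqp), by linarith⟩
  choose! q s t hq hst hP using hstep
  -- Non-separation gives `s i ≤ t (i+1) ≤ s (i+1) + Λ` at each step.
  have hwalk : ∀ i : ℕ, i ≤ M → s 0 ≤ s i + i * Λ := by
    intro i
    induction i with
    | zero => simp
    | succ i ih =>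
      intro hi
      have hiM : i ≤ M := by omega
      have hi' : (i : ℝ) * (p / M) ≤ p := by
        rw [mul_div_assoc', div_le_iff₀ hM0, mul_comm]
        gcongr
      have hi0 : 0 ≤ (i : ℝ) * (p / M) := by positivity
      have hd : (q (i + 1) : ℝ) - q i = p / M := by
        rw [hq _ hi, hq _ hiM]; push_cast; ring
      have := le_of_binomialRandom_real_Icc (q i) (q (i + 1)) (by rw [hq _ hiM]; linarith)
        (by rw [hq _ hiM]; linarith) (by
          rw [hd, hq _ hiM, div_pow, mul_div_assoc', div_le_iff₀ (by positivity)]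
          have h1 : ((n : ℝ) * √(p : ℝ)) ^ 2 ≤ (M : ℝ) ^ 2 := by gcongr
          have h2 : ((n : ℝ) * √(p : ℝ)) ^ 2 = (n : ℝ) ^ 2 * p := by
            rw [mul_pow, pow_two √(p : ℝ), hsq]
          calc (n : ℝ) ^ 2 * (p : ℝ) ^ 2 = (p : ℝ) * (((n : ℝ) * √(p : ℝ)) ^ 2) := by
                rw [h2]; ring
            _ ≤ ((p : ℝ) + i * (p / M)) * (M : ℝ) ^ 2 := by
              gcongr
              linarith) (fun G => (dominationNumber G : ℝ)) (hP i hiM) (hP (i + 1) hi)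
      have h3 := hst (i + 1) hi
      have h4 := ih hiM
      push_cast
      linarith
  have hlow : 7 / 8 * l / p ≤ t 0 := by
    by_contra! hlt
    have hq0 : q 0 = p := Subtype.ext (by simpa using hq 0 (Nat.zero_le _))
    have h1 := binomialRandom_real_dominationNumber_lt_le n p hp0 hp (by linarith) hx hlx hl2
    have h2 := hP 0 (Nat.zero_le _)
    rw [hq0] at h2
    have h3 := h2.trans_le (measureReal_mono fun G hG => hG.2.trans_lt hlt)
    linarith [h3.trans_le h1]
  have hup : s M ≤ (l' + 2) / (2 * p) + 1 := by
    by_contra! hlt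
    have hqM : (q M : ℝ) = 2 * p := by
      rw [hq M le_rfl]; field_simp; ring
    have h1 := binomialRandom_real_le_dominationNumber_le n (q M) (by rw [hqM]; positivity)
      (l := l') (by linarith) (by rw [hqM, hl'exp, ← hx]; ring) (by rw [hl'exp]; linarith)
    have h2 := hP M le_rfl
    rw [hqM] at h1
    have h3 := h2.trans_le (measureReal_mono fun G hG => hlt.le.trans hG.1)
    linarith [h3.trans_le h1]
  -- The walk costs `M * Λ`, and passing from `t 0` to `s 0` one more `Λ`. As `n√p ≥ 16`, `M + 1 ≤
  -- (9/8) n√p`; with `ε ≤ 1/4` this gives `9/32`.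
  have hshift : (M + 1) * Λ ≤ 9 / 32 * l' / p := by
    have h16 : 16 ≤ (n : ℝ) * √(p : ℝ) := by
      have : (n : ℝ) * p ≤ n * √(p : ℝ) := by
        gcongr
        nlinarith [Real.sqrt_le_one.2 (by linarith : (p : ℝ) ≤ 1)]
      linarith
    have h1 : (M : ℝ) + 1 ≤ 9 / 8 * (n * √(p : ℝ)) := by linarith
    calc (M + 1) * Λ ≤ 9 / 8 * (n * √(p : ℝ)) * (1 / 4 * l' / (n * (p * √(p : ℝ)))) := by
          rw [hΛ]; gcongr
      _ = 9 / 32 * l' / p := by field_simp; ring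
  have hw := hwalk M le_rfl
  have h0 := hst 0 (Nat.zero_le _)
  have hfin : 7 / 8 * l / p ≤ (l' + 2) / (2 * p) + 1 + 9 / 32 * l' / p := by linarith
  -- Here `25/32 = 1/2 + 9/32` is below `7/8`, and `l ≥ 31` absorbs the bounded terms.
  have e : (l' + 2) / (2 * p) + 1 + 9 / 32 * l' / p = (25 / 32 * l' + 1 + p) / p := by
    field_simp; ring
  rw [e, div_le_div_iff_of_pos_right hp0] at hfin
  linarith

end DominationAnti

/-! ### Passage to the asymptotic statement. -/

theorem mainTheorem4 (ε : ℝ) (hε : 0 < ε) (hε' : ε ≤ 1 / 4) (p : ℕ → I)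
    (hp : (fun n : ℕ => ((n : ℝ))⁻¹) =o[atTop] (fun n : ℕ => (p n : ℝ)))
    (hp' : (fun n : ℕ => (p n : ℝ)) =o[atTop] (fun _ : ℕ => (1 : ℝ))) :
    ∃ᶠ n : ℕ in atTop, ∃ q : I, (p n : ℝ) ≤ (q : ℝ) ∧ (q : ℝ) ≤ 2 * (p n : ℝ) ∧
      ∀ s t : ℝ, t - s ≤ ε * Real.log ((n : ℝ) * (q : ℝ)) / ((n : ℝ) * (q : ℝ) ^ (3 / 2 : ℝ)) →
        (SimpleGraph.binomialRandom (Fin n) q).real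
          {G | (DominationAnti.dominationNumber G : ℝ) ∈ Set.Icc s t} ≤ 1 - ε := by
  -- The conclusion in fact holds for all sufficiently large `n`.
  refine Eventually.frequently ?_
  have hsmall : ∀ᶠ n : ℕ in atTop, (p n : ℝ) ≤ 1 / 16 :=
    ((isLittleO_one_iff ℝ).1 hp').eventually_le_const (by norm_num)
  have hpos : ∀ᶠ n : ℕ in atTop, 0 < (n : ℝ) * p n := by
    filter_upwards [hp.bound one_pos, eventually_gt_atTop 0] with n h hn
    have hn' : (0 : ℝ) < n := by exact_mod_cast hn
    rw [one_mul, Real.norm_of_nonneg (by positivity), Real.norm_of_nonneg (p n).2.1] at h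
    have : (0 : ℝ) < (n : ℝ)⁻¹ := by positivity
    have : (0 : ℝ) < p n := by linarith
    positivity
  have htop : Tendsto (fun n : ℕ => (n : ℝ) * p n) atTop atTop := by
    have h := hp.tendsto_div_nhds_zero
    have h2 : Tendsto (fun n : ℕ => ((n : ℝ)⁻¹ / p n)) atTop (nhdsWithin 0 (Set.Ioi 0)) := by
      refine tendsto_nhdsWithin_iff.2 ⟨h, hpos.mono fun n hn => ?_⟩
      rw [Set.mem_Ioi, ← one_div, div_div]
      positivity
    refine h2.inv_tendsto_nhdsGT_zero.congr fun n => ?_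
    simp
    ring
  have hlog : Tendsto (fun n : ℕ => Real.log ((n : ℝ) * p n)) atTop atTop :=
    Real.tendsto_log_atTop.comp htop
  have hexp1 : ∀ᶠ l : ℝ in atTop, 2 * l ≤ Real.exp l := by
    filter_upwards [((Real.tendsto_exp_div_pow_atTop 1).eventually_ge_atTop 2),
      eventually_gt_atTop 0] with l h hl
    rwa [pow_one, le_div_iff₀ hl] at h
  have hexp2 : ∀ᶠ l : ℝ in atTop, 4 + 2 * l ^ 2 ≤ Real.exp (l / 15) := by
    have h15 : Tendsto (fun l : ℝ => l / 15) atTop atTop :=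
      tendsto_id.atTop_div_const (by norm_num)
    -- The constant `900 = 4 * 15²` gives `exp (l/15) ≥ 4 * l²`, which suffices once `l ≥ 2`.
    filter_upwards [h15.eventually ((Real.tendsto_exp_div_pow_atTop 2).eventually_ge_atTop 900),
      eventually_ge_atTop 2] with l h hl
    rw [le_div_iff₀ (by positivity)] at h
    nlinarith
  filter_upwards [hsmall, hpos, hlog.eventually_ge_atTop 31, hlog.eventually hexp1,
    hlog.eventually hexp2] with n h1 h2 h3 h4 h5
  exact DominationAnti.exists_binomialRandom_real_dominationNumber_le hε hε' n (p n)
    (pos_of_mul_pos_right h2 (Nat.cast_nonneg n)) h1 h3 (Real.exp_log h2).symm h4 h5
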